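/- **Theorem (computational lower bound for estimating $x^\star$).** Let $n,d\ge 1$ be integers, $K_n\in\{1,\dots,n\}$, $K_d\in\{1,\dots,d\}$ and $\lambda\in[0,1]$. Let $S\subset\{1,\dots,n\}$ and $T\subset\{1,\dots,d\}$ be independent random subsets, where each $i$ belongs to $S$ independently with probability $K_n/n$ and each $k$ belongs to $T$ independently with probability $K_d/d$. Put $M=\lambda\mathbf 1\{S\times T\}$, i.e. $M_{i,k}=\lambda$ if $i\in S$ and $k\in T$, and $M_{i,k}=0$ otherwise. Conditionally on $(S,T)$, the entries of $Y\in\{-1,1\}^{n\times d}$ are independent with $\mathbb P(Y_{i,k}=\pm1\mid S,T)=(1\pm M_{i,k})/2$. Write $\mathbb E$ for the expectation under the joint law of $(S,T,Y)$, and let $x^\star=\mathbf 1\{\exists k:\ M_{1,k}>0\}$ be the indicator that the first row meets the hidden block. There is a universal constant $c_0>0$ such that the following holds for every $c_{\mathrm s}\ge c_0$, every integer $D\ge 2$ and all $n,d,K_n,K_d,\lambda$ as above. If $$\frac{K_n}{n}\ \vee\ \frac{K_d}{d}\ \vee\ \frac{\lambda K_n}{\sqrt n}\ \vee\ \frac{\lambda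 K_d}{\sqrt d}\ \vee\ \lambda\ \le\ D^{-8c_{\mathrm s}},$$ then every real polynomial $f$ of total degree at most $D$ in the $nd$ entries of $Y$ satisfies $$\mathbb E\big[(f(Y)-x^\star)^2\big]\ \ge\ \frac{\mathbb E[x^{\star 2}]}{2}.$$ The same inequality holds when $x^\star$ is replaced by $\mathbf 1\{1\in S\}$ (which differs from $x^\star$ only when $\lambda=0$ or $T=\emptyset$). -/

import Mathlib

namespace HiddenBlock

noncomputable section

/-- The block matrix `M = lam * 1{S × T}`. -/
def blockMatrix {n d : ℕ} (lam : ℝ) (S : Finset (Fin n)) (T : Finset (Fin d)) :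
    Matrix (Fin n) (Fin d) ℝ :=
  fun i k => if i ∈ S ∧ k ∈ T then lam else 0

/-- Probability of the random subset `S` of `[m]` when each element is included independently
with probability `p`. -/
def subsetProb {m : ℕ} (p : ℝ) (S : Finset (Fin m)) : ℝ :=
  ∏ i, if i ∈ S then p else 1 - p

/-- Sign matrices, i.e. elements of `{-1, 1}^{n × d}`. -/
abbrev SignMatrix (n d : ℕ) : Type := Fin n → Fin d → ℤˣ

/-- The `(i, k)` entry of a sign matrix, as a real number. -/
def entry {n d : ℕ} (Y : SignMatrix n d) (ik : Fin n × Fin d) : ℝ :=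
  ((Y ik.1 ik.2 : ℤ) : ℝ)

/-- Conditional probability of `Y` given `M`: the entries of `Y` are independent, valued in
`{-1, 1}`, and `Y i k` has mean `M i k`, so that `P(Y i k = y) = (1 + y * M i k) / 2`. -/
def obsProb {n d : ℕ} (M : Matrix (Fin n) (Fin d) ℝ) (Y : SignMatrix n d) : ℝ :=
  ∏ ik : Fin n × Fin d, (1 + entry Y ik * M ik.1 ik.2) / 2

/-- Joint probability of `(S, T, Y)`: rows are selected independently with probability `Kn / n`,
columns independently with probability `Kd / d`, and `Y` is observed given
`M = lam * 1{S × T}`. -/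
def jointProb {n d : ℕ} (lam : ℝ) (Kn Kd : ℕ)
    (S : Finset (Fin n)) (T : Finset (Fin d)) (Y : SignMatrix n d) : ℝ :=
  subsetProb ((Kn : ℝ) / n) S * subsetProb ((Kd : ℝ) / d) T * obsProb (blockMatrix lam S T) Y

/-- Expectation of a function `g` of `(S, T, Y)` in this (finite) model. -/
def expectation (n d : ℕ) (lam : ℝ) (Kn Kd : ℕ)
    (g : Finset (Fin n) → Finset (Fin d) → SignMatrix n d → ℝ) : ℝ :=
  ∑ S, ∑ T, ∑ Y, jointProb lam Kn Kd S T Y * g S T Y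

open Classical in
/-- The indicator that row `i` of `M` has a positive entry. -/
def rowPositive {n d : ℕ} (M : Matrix (Fin n) (Fin d) ℝ) (i : Fin n) : ℝ :=
  if ∃ k, 0 < M i k then 1 else 0

/-- The indicator that row `i` belongs to `S`. -/
def rowSelected {n : ℕ} (S : Finset (Fin n)) (i : Fin n) : ℝ :=
  if i ∈ S then 1 else 0

/-- Value at the observation `Y` of a polynomial in the `n * d` entries. -/
def polyValue {n d : ℕ} (f : MvPolynomial (Fin n × Fin d) ℝ) (Y : SignMatrix n d) : ℝ :=
  MvPolynomial.eval (entry Y) f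

/-- The signal condition: all five quantities are at most `D ^ (-8 c)`. -/
def SignalCondition (n d D : ℕ) (lam : ℝ) (Kn Kd : ℕ) (c : ℝ) : Prop :=
  max (max (max (max ((Kn : ℝ) / n) ((Kd : ℝ) / d)) (lam * Kn / Real.sqrt n))
    (lam * Kd / Real.sqrt d)) lam ≤ (D : ℝ) ^ (-8 * c)

theorem sum_subsetProb {m : ℕ} (p : ℝ) : ∑ S : Finset (Fin m), subsetProb p S = 1 := by
  have h := Finset.prod_add (fun _ : Fin m => p) (fun _ => 1 - p) Finset.univ
  simp only [add_sub_cancel, Finset.prod_const_one, Finset.powerset_univ] at h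
  rw [h]
  refine Finset.sum_congr rfl fun S _ => ?_
  rw [subsetProb, Finset.prod_ite]
  congr 1 <;> exact Finset.prod_congr (by ext; simp) fun _ _ => rfl

theorem sum_obsProb {n d : ℕ} (M : Matrix (Fin n) (Fin d) ℝ) :
    ∑ Y : SignMatrix n d, obsProb M Y = 1 := by
  have h1 : ∀ i k, ∑ u : ℤˣ, (1 + ((u : ℤ) : ℝ) * M i k) / 2 = 1 := by
    intro i k
    rw [show (Finset.univ : Finset ℤˣ) = {1, -1} from rfl, Finset.sum_pair (by decide)]
    push_cast
    ring
  simp only [obsProb, entry, Fintype.prod_prod_type]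
  rw [← Fintype.piFinset_univ, ← Finset.prod_univ_sum (fun _ => Finset.univ)
    (fun i (y : Fin d → ℤˣ) => ∏ k, (1 + ((y k : ℤ) : ℝ) * M i k) / 2)]
  refine Finset.prod_eq_one fun i _ => ?_
  rw [← Fintype.piFinset_univ, ← Finset.prod_univ_sum (fun _ => Finset.univ)
    (fun k (u : ℤˣ) => (1 + ((u : ℤ) : ℝ) * M i k) / 2)]
  exact Finset.prod_eq_one fun k _ => h1 i k

/-- The total mass is one. -/
theorem expectation_one {n d : ℕ} (lam : ℝ) (Kn Kd : ℕ) :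
    expectation n d lam Kn Kd (fun _ _ _ => 1) = 1 := by
  simp only [expectation, jointProb, mul_one, ← Finset.mul_sum, sum_obsProb, sum_subsetProb]

/-- The joint probabilities are nonnegative. -/
theorem jointProb_nonneg {n d : ℕ} {lam : ℝ} (h0 : 0 ≤ lam) (h1 : lam ≤ 1) {Kn Kd : ℕ}
    (hn : Kn ≤ n) (hd : Kd ≤ d)
    (S : Finset (Fin n)) (T : Finset (Fin d)) (Y : SignMatrix n d) :
    0 ≤ jointProb lam Kn Kd S T Y := by
  have key : ∀ {m K : ℕ} (_ : K ≤ m) (U : Finset (Fin m)), 0 ≤ subsetProb ((K : ℝ) / m) U := by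
    intro m K h U
    refine Finset.prod_nonneg fun i _ => ?_
    have : (K : ℝ) / m ≤ 1 := div_le_one_of_le₀ (by exact_mod_cast h) (by positivity)
    split_ifs
    · positivity
    · linarith
  refine mul_nonneg (mul_nonneg (key hn S) (key hd T)) (Finset.prod_nonneg fun ik _ => ?_)
  have hM : 0 ≤ blockMatrix lam S T ik.1 ik.2 ∧ blockMatrix lam S T ik.1 ik.2 ≤ 1 := by
    unfold blockMatrix
    split_ifs <;> constructor <;> linarith
  rcases Int.units_eq_one_or (Y ik.1 ik.2) with h | h <;> simp only [entry, h] <;> push_cast <;>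
    linarith [hM.1, hM.2]

end

end HiddenBlock

/-!
Mean squared error is controlled by duality: if a random variable `W` has the same correlation as
the target `x` with every polynomial of degree at most `D` in `Y`, then
`𝔼 (f(Y) - x) ^ 2 ≥ 𝔼 x ^ 2 - 𝔼 W ^ 2` for each such polynomial, because `𝔼 (f(Y) - W) ^ 2 ≥ 0`.

For `x = 1{z ∈ S}` take `W = ∑ κ b * ∏ e ∈ b, (Y e - M e) / (1 - M e ^ 2)` over the sets `b` of
at most `D` entries, where `κ b` is the joint cumulant of `x` and of the entries of `M` in `b`.
Matching the correlations with monomials is exactly the recursion that defines cumulants, and the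
summands are orthogonal given `M`, so `𝔼 W ^ 2 ≤ ∑ κ b ^ 2 * 2 ^ #b`. View `b` as the edge set of a
bipartite graph. The cumulant vanishes unless all components of `b` meet the row `z`, and such
graphs are grown by attaching one edge at a time, where each attachment costs a factor of at most
`1 / 2` in the low signal regime. Hence `𝔼 W ^ 2 ≤ 2 * p ^ 2` with `p = ℙ(z ∈ S)`, which is small
compared with `𝔼 x ^ 2 = p`.

The indicator that row `z` meets the block is `x - x * 1{T = ∅}`, and for it `W` is corrected by
`p * 1{T = ∅}`.
-/

namespace HiddenBlock

open Finset

section RelativeCumulant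

variable {E R : Type*} [DecidableEq E] [CommRing R]

/-- The solution `κ` of the recursion `∑ b ⊆ a, κ b * m (a \ b) = r a` (for `m ∅ = 1`). If
`m a = 𝔼[∏ e ∈ a, X e]` and `r a = 𝔼[x * ∏ e ∈ a, X e]`, then `κ a` is the joint cumulant of `x`
and of the `X e` with `e ∈ a`. -/
def relativeCumulant (r m : Finset E → R) (a : Finset E) : R :=
  r a - ∑ b ∈ a.ssubsets.attach, relativeCumulant r m b * m (a \ b)
termination_by #a
decreasing_by exact card_lt_card (mem_ssubsets.1 b.2)

variable {r m : Finset E → R}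

theorem relativeCumulant_eq (a : Finset E) :
    relativeCumulant r m a = r a - ∑ b ∈ a.ssubsets, relativeCumulant r m b * m (a \ b) := by
  rw [relativeCumulant, sum_attach a.ssubsets fun b => relativeCumulant r m b * m (a \ b)]

theorem add_sum_ssubsets (a : Finset E) (g : Finset E → R) :
    g a + ∑ b ∈ a.ssubsets, g b = ∑ b ∈ a.powerset, g b :=
  add_sum_erase _ _ (mem_powerset_self a)

theorem sum_powerset_relativeCumulant_mul (hm : m ∅ = 1) (a : Finset E) :
    ∑ b ∈ a.powerset, relativeCumulant r m b * m (a \ b) = r a := by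
  rw [← add_sum_ssubsets, Finset.sdiff_self, hm, mul_one, relativeCumulant_eq, sub_add_cancel]

theorem relativeCumulant_union_eq_zero (hm₁ : m ∅ = 1) {a b : Finset E} (hab : Disjoint a b)
    (hb : b.Nonempty) (hr : ∀ a' ⊆ a, ∀ b' ⊆ b, r (a' ∪ b') = r a' * m b')
    (hm : ∀ a' ⊆ a, ∀ b' ⊆ b, m (a' ∪ b') = m a' * m b') :
    relativeCumulant r m (a ∪ b) = 0 := by
  generalize hs : a ∪ b = s
  induction s using Finset.strongInduction generalizing a b with
  | H s ih =>
    subst hs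
    have vanish : ∀ t ∈ (a ∪ b).ssubsets, t ∉ a.powerset →
        relativeCumulant r m t * m ((a ∪ b) \ t) = 0 := by
      intro t ht hta
      rw [mem_ssubsets] at ht
      have htb : (t ∩ b).Nonempty := by
        rw [mem_powerset, not_subset] at hta
        obtain ⟨e, he, hea⟩ := hta
        exact ⟨e, mem_inter.2 ⟨he, (mem_union.1 (ht.subset he)).resolve_left hea⟩⟩
      have ht' : t ∩ a ∪ t ∩ b = t := by rw [← inter_union_distrib_left, inter_eq_left.2 ht.subset]
      rw [ih t ht (hab.mono inter_subset_right inter_subset_right) htb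
        (fun a' ha b' hb => hr a' (ha.trans inter_subset_right) b' (hb.trans inter_subset_right))
        (fun a' ha b' hb => hm a' (ha.trans inter_subset_right) b' (hb.trans inter_subset_right))
        ht', zero_mul]
    have factor : ∀ t ∈ a.powerset, relativeCumulant r m t * m ((a ∪ b) \ t) =
        relativeCumulant r m t * m (a \ t) * m b := by
      intro t ht
      rw [union_sdiff_distrib, sdiff_eq_self_of_disjoint (hab.symm.mono_right (mem_powerset.1 ht)),
        hm _ sdiff_subset _ subset_rfl, mul_assoc]
    have a_ssubset : a ⊂ a ∪ b :=
      subset_union_left.ssubset_of_ne fun h =>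
        hb.ne_empty (disjoint_self_iff_empty _ |>.1 (hab.mono_left (h ▸ subset_union_right)))
    have powerset_subset : a.powerset ⊆ (a ∪ b).ssubsets := fun t ht =>
      mem_ssubsets.2 ((mem_powerset.1 ht).trans_ssubset a_ssubset)
    rw [relativeCumulant_eq, ← sum_subset powerset_subset vanish, sum_congr rfl factor, ← sum_mul,
      sum_powerset_relativeCumulant_mul hm₁, hr _ subset_rfl _ subset_rfl, sub_self]

theorem abs_relativeCumulant_le [LinearOrder R] [IsStrictOrderedRing R] (hr : ∀ a, 0 ≤ r a)
    (hm : ∀ a, 0 ≤ m a) (hrm : ∀ a, ∀ b ⊆ a, r b * m (a \ b) ≤ r a) (a : Finset E) :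
    |relativeCumulant r m a| ≤ ((#a : R) + 1) ^ #a * r a := by
  induction a using Finset.strongInduction with
  | H a ih =>
    have term_le : ∀ b ∈ a.ssubsets,
        |relativeCumulant r m b * m (a \ b)| ≤ (#a : R) ^ #b * r a := by
      intro b hb
      rw [mem_ssubsets] at hb
      have card_lt : (#b : R) + 1 ≤ #a := by exact_mod_cast card_lt_card hb
      calc |relativeCumulant r m b * m (a \ b)|
          ≤ ((#b : R) + 1) ^ #b * r b * m (a \ b) := by
            rw [abs_mul, abs_of_nonneg (hm _)]
            exact mul_le_mul_of_nonneg_right (ih b hb) (hm _)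
        _ = ((#b : R) + 1) ^ #b * (r b * m (a \ b)) := mul_assoc _ _ _
        _ ≤ (#a : R) ^ #b * r a :=
            mul_le_mul (by gcongr) (hrm a b hb.subset) (mul_nonneg (hr b) (hm _)) (by positivity)
    have binomial : (#a : R) ^ #a + ∑ b ∈ a.ssubsets, (#a : R) ^ #b = (#a + 1) ^ #a := by
      rw [add_sum_ssubsets a fun b => (#a : R) ^ #b, ← sum_pow_mul_eq_add_pow]
      simp only [one_pow, mul_one]
    have one_le : (1 : R) ≤ (#a : R) ^ #a := by exact_mod_cast Nat.pow_self_pos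
    calc |relativeCumulant r m a|
        ≤ |r a| + |∑ b ∈ a.ssubsets, relativeCumulant r m b * m (a \ b)| := by
          rw [relativeCumulant_eq]
          exact abs_sub _ _
      _ ≤ (#a : R) ^ #a * r a + ∑ b ∈ a.ssubsets, (#a : R) ^ #b * r a := by
          rw [abs_of_nonneg (hr a)]
          exact add_le_add (le_mul_of_one_le_left (hr a) one_le)
            ((abs_sum_le_sum_abs _ _).trans (sum_le_sum term_le))
      _ = ((#a : R) + 1) ^ #a * r a := by rw [← sum_mul, ← add_mul, binomial]

end RelativeCumulant

section BlockMoment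

variable {ι κ : Type*} [DecidableEq ι] [DecidableEq κ]

/-- The moment `𝔼[1{R ⊆ S} * ∏ (i, k) ∈ a, lam * 1{i ∈ S, k ∈ T}]` when every row belongs to `S`
with probability `p` and every column to `T` with probability `q`, all independently. A set of
entries is viewed as the edge set of a bipartite graph between rows and columns. -/
def blockMoment (lam p q : ℝ) (R : Finset ι) (a : Finset (ι × κ)) : ℝ :=
  lam ^ #a * p ^ #(R ∪ a.image Prod.fst) * q ^ #(a.image Prod.snd)

/-- The joint cumulant of `1{R ⊆ S}` and of the entries of the hidden block indexed by `a`. -/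
def blockCumulant (lam p q : ℝ) (R : Finset ι) : Finset (ι × κ) → ℝ :=
  relativeCumulant (blockMoment lam p q R) (blockMoment lam p q ∅)

/-- The edges `b` share no vertex with the edges `a` nor with the rows `R`. -/
def Separated (R : Finset ι) (a b : Finset (ι × κ)) : Prop :=
  Disjoint (R ∪ a.image Prod.fst) (b.image Prod.fst) ∧
    Disjoint (a.image Prod.snd) (b.image Prod.snd)

variable {lam p q : ℝ} {R R' : Finset ι} {a a' b b' : Finset (ι × κ)}
  {e : ι × κ}

theorem blockMoment_empty : blockMoment lam p q R (∅ : Finset (ι × κ)) = p ^ #R := by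
  simp [blockMoment]

theorem blockMoment_nonneg (hlam : 0 ≤ lam) (hp : 0 ≤ p) (hq : 0 ≤ q) (R : Finset ι)
    (a : Finset (ι × κ)) : 0 ≤ blockMoment lam p q R a := by
  unfold blockMoment
  positivity

theorem blockMoment_mul_blockMoment_sdiff_le (hlam : 0 ≤ lam) (hp : 0 ≤ p) (hp₁ : p ≤ 1)
    (hq : 0 ≤ q) (hq₁ : q ≤ 1) (hba : b ⊆ a) :
    blockMoment lam p q R b * blockMoment lam p q ∅ (a \ b) ≤ blockMoment lam p q R a := by
  have edges : #a = #b + #(a \ b) := by rw [add_comm, card_sdiff_add_card_eq_card hba]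
  have rows : #(R ∪ a.image Prod.fst) ≤
      #(R ∪ b.image Prod.fst) + #(∅ ∪ (a \ b).image Prod.fst) := by
    nth_rw 1 [← union_sdiff_of_subset hba]
    rw [image_union, ← union_assoc, empty_union]
    exact card_union_le _ _
  have columns : #(a.image Prod.snd) ≤ #(b.image Prod.snd) + #((a \ b).image Prod.snd) := by
    nth_rw 1 [← union_sdiff_of_subset hba]
    rw [image_union]
    exact card_union_le _ _
  calc blockMoment lam p q R b * blockMoment lam p q ∅ (a \ b)
      = lam ^ #a * p ^ (#(R ∪ b.image Prod.fst) + #(∅ ∪ (a \ b).image Prod.fst)) *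
          q ^ (#(b.image Prod.snd) + #((a \ b).image Prod.snd)) := by
        rw [blockMoment, blockMoment, edges]
        ring
    _ ≤ blockMoment lam p q R a := by
        unfold blockMoment
        gcongr ?_ * ?_ * ?_
        · exact pow_le_pow_of_le_one hp hp₁ rows
        · exact pow_le_pow_of_le_one hq hq₁ columns

theorem abs_blockCumulant_le (hlam : 0 ≤ lam) (hp : 0 ≤ p) (hp₁ : p ≤ 1) (hq : 0 ≤ q)
    (hq₁ : q ≤ 1) (R : Finset ι) (a : Finset (ι × κ)) :
    |blockCumulant lam p q R a| ≤ ((#a : ℝ) + 1) ^ #a * blockMoment lam p q R a :=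
  abs_relativeCumulant_le (blockMoment_nonneg hlam hp hq R) (blockMoment_nonneg hlam hp hq ∅)
    (fun _ _ hba => blockMoment_mul_blockMoment_sdiff_le hlam hp hp₁ hq hq₁ hba) a

theorem Separated.disjoint (h : Separated R a b) : Disjoint a b :=
  disjoint_left.2 fun _ ha hb =>
    disjoint_left.1 h.2 (mem_image_of_mem _ ha) (mem_image_of_mem _ hb)

theorem Separated.mono (h : Separated R a b) (hR : R' ⊆ R) (ha : a' ⊆ a) (hb : b' ⊆ b) :
    Separated R' a' b' :=
  ⟨h.1.mono (union_subset_union hR (image_subset_image ha)) (image_subset_image hb),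
    h.2.mono (image_subset_image ha) (image_subset_image hb)⟩

theorem Separated.blockMoment_union (h : Separated R a b) :
    blockMoment lam p q R (a ∪ b) = blockMoment lam p q R a * blockMoment lam p q ∅ b := by
  rw [blockMoment, blockMoment, blockMoment, card_union_of_disjoint h.disjoint, image_union,
    image_union, ← union_assoc, empty_union, card_union_of_disjoint h.1,
    card_union_of_disjoint h.2]
  ring

theorem Separated.blockCumulant_union (h : Separated R a b) (hb : b.Nonempty) :
    blockCumulant lam p q R (a ∪ b) = 0 :=
  relativeCumulant_union_eq_zero blockMoment_empty h.disjoint hb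
    (fun _ ha' _ hb' => (h.mono subset_rfl ha' hb').blockMoment_union)
    (fun _ ha' _ hb' => (h.mono (empty_subset R) ha' hb').blockMoment_union)

theorem blockMoment_insert (he : e ∉ a) :
    blockMoment lam p q R (insert e a) = blockMoment lam p q R a *
      (lam * (if e.1 ∈ R ∪ a.image Prod.fst then 1 else p) *
        (if e.2 ∈ a.image Prod.snd then 1 else q)) := by
  rw [blockMoment, blockMoment, card_insert_of_notMem he, image_insert, image_insert,
    union_insert, card_insert_eq_ite, card_insert_eq_ite (s := a.image Prod.snd)]
  split_ifs <;> ring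

end BlockMoment

section Clusters

theorem sum_ite_mem_one_le_card_add {ι : Type*} [Fintype ι] [DecidableEq ι] (A : Finset ι) {x : ℝ}
    (hx : 0 ≤ x) : ∑ i, (if i ∈ A then 1 else x) ≤ #A + Fintype.card ι * x := by
  calc ∑ i, (if i ∈ A then 1 else x) ≤ ∑ i, ((if i ∈ A then 1 else 0) + x) := by
        gcongr with i
        split_ifs <;> linarith
    _ = #A + Fintype.card ι * x := by simp [sum_add_distrib]

variable {ι κ : Type*} [Fintype ι] [Fintype κ] [DecidableEq ι] [DecidableEq κ]

/-- The edges outside `a` that share a vertex with `a` or start at one of the rows `R`. -/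
def boundary (R : Finset ι) (a : Finset (ι × κ)) : Finset (ι × κ) :=
  {e | e ∉ a ∧ (e.1 ∈ R ∪ a.image Prod.fst ∨ e.2 ∈ a.image Prod.snd)}

/-- The sets of `k` edges all of whose connected components meet the rows `R`, generated by
attaching one edge at a time. -/
def clusters (R : Finset ι) : ℕ → Finset (Finset (ι × κ))
  | 0 => {∅}
  | k + 1 => ((clusters R k).sigma (boundary R)).image fun x => insert x.2 x.1

variable {lam p q : ℝ} {R : Finset ι} {a : Finset (ι × κ)} {e : ι × κ} {k D : ℕ}

theorem mem_boundary :
    e ∈ boundary R a ↔ e ∉ a ∧ (e.1 ∈ R ∪ a.image Prod.fst ∨ e.2 ∈ a.image Prod.snd) := by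
  simp only [boundary, mem_filter, mem_univ, true_and]

theorem insert_mem_clusters (ha : a ∈ clusters R k) (he : e ∈ boundary R a) :
    insert e a ∈ clusters R (k + 1) :=
  mem_image.2 ⟨⟨a, e⟩, mem_sigma.2 ⟨ha, he⟩, rfl⟩

theorem card_of_mem_clusters (h : a ∈ clusters R k) : #a = k := by
  induction k generalizing a with
  | zero => rw [mem_singleton.1 h, card_empty]
  | succ k ih =>
    obtain ⟨⟨b, e⟩, hbe, rfl⟩ := mem_image.1 h
    obtain ⟨hb, he⟩ := mem_sigma.1 hbe
    rw [card_insert_of_notMem (mem_boundary.1 he).1, ih hb]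

theorem exists_subset_mem_clusters_separated (R : Finset ι) (a : Finset (ι × κ)) :
    ∃ b ⊆ a, b ∈ clusters R #b ∧ Separated R b (a \ b) := by
  obtain ⟨b, hb, hmax⟩ := exists_max_image (a.powerset.filter fun b => b ∈ clusters R #b)
    card ⟨∅, by simp [clusters]⟩
  simp only [mem_filter, mem_powerset] at hb hmax
  have no_boundary : ∀ e ∈ a \ b, e ∉ boundary R b := by
    intro e he hbound
    rw [mem_sdiff] at he
    have card_insert := card_insert_of_notMem he.2
    have := hmax (insert e b) ⟨insert_subset he.1 hb.1,
      card_insert ▸ insert_mem_clusters hb.2 hbound⟩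
    omega
  refine ⟨b, hb.1, hb.2, ?_, ?_⟩ <;> rw [disjoint_right] <;> intro v hv hv' <;>
    obtain ⟨e, he, rfl⟩ := mem_image.1 hv <;>
    refine no_boundary e he (mem_boundary.2 ⟨(mem_sdiff.1 he).2, ?_⟩)
  · exact Or.inl hv'
  · exact Or.inr hv'

theorem mem_clusters_of_blockCumulant_ne_zero (h : blockCumulant lam p q R a ≠ 0) :
    a ∈ clusters R #a := by
  obtain ⟨b, hba, hb, hsep⟩ := exists_subset_mem_clusters_separated R a
  rcases (a \ b).eq_empty_or_nonempty with hdiff | hdiff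
  · rwa [(sdiff_eq_empty_iff_subset.1 hdiff).antisymm hba]
  · exact absurd (union_sdiff_of_subset hba ▸ hsep.blockCumulant_union hdiff) h

theorem sum_mul_le_of_subset_union_product {s : Finset (ι × κ)} {A : Finset ι} {B : Finset κ}
    {u : ι → ℝ} {v : κ → ℝ} (hs : s ⊆ A ×ˢ univ ∪ univ ×ˢ B) (hu : ∀ i, 0 ≤ u i)
    (hv : ∀ j, 0 ≤ v j) :
    ∑ e ∈ s, u e.1 * v e.2 ≤ (∑ i ∈ A, u i) * ∑ j, v j + (∑ i, u i) * ∑ j ∈ B, v j := by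
  have nonneg : ∀ e : ι × κ, 0 ≤ u e.1 * v e.2 := fun e => mul_nonneg (hu _) (hv _)
  rw [sum_mul_sum, sum_mul_sum, ← sum_product', ← sum_product', ← sum_union_inter]
  exact (sum_le_sum_of_subset_of_nonneg hs fun e _ _ => nonneg e).trans
    (le_add_of_nonneg_right (sum_nonneg fun e _ => nonneg e))

theorem sum_boundary_blockMoment_sq_le (R : Finset ι) (a : Finset (ι × κ)) :
    ∑ e ∈ boundary R a, blockMoment lam p q R (insert e a) ^ 2 ≤
      blockMoment lam p q R a ^ 2 * (lam ^ 2 *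
        (#(R ∪ a.image Prod.fst) * (#(a.image Prod.snd) + Fintype.card κ * q ^ 2) +
          (#(R ∪ a.image Prod.fst) + Fintype.card ι * p ^ 2) * #(a.image Prod.snd))) := by
  set A := R ∪ a.image Prod.fst with hA
  set B := a.image Prod.snd with hB
  let u : ι → ℝ := fun i => if i ∈ A then 1 else p ^ 2
  let v : κ → ℝ := fun j => if j ∈ B then 1 else q ^ 2
  have u_nonneg : ∀ i, 0 ≤ u i := fun i => ite_nonneg zero_le_one (sq_nonneg p)
  have v_nonneg : ∀ j, 0 ≤ v j := fun j => ite_nonneg zero_le_one (sq_nonneg q)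
  have insert_sq : ∀ e ∈ boundary R a, blockMoment lam p q R (insert e a) ^ 2 =
      blockMoment lam p q R a ^ 2 * (lam ^ 2 * (u e.1 * v e.2)) := by
    intro e he
    rw [blockMoment_insert (mem_boundary.1 he).1]
    simp only [u, v, hA, hB, mul_pow, ite_pow, one_pow, mul_assoc]
  have boundary_subset : boundary R a ⊆ A ×ˢ univ ∪ univ ×ˢ B := fun e he => by
    have touches : e.1 ∈ A ∨ e.2 ∈ B := (mem_boundary.1 he).2
    simpa using touches
  have sum_u : ∑ i ∈ A, u i = #A := by simp +contextual [u]
  have sum_v : ∑ j ∈ B, v j = #B := by simp +contextual [v]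
  rw [sum_congr rfl insert_sq, ← mul_sum, ← mul_sum]
  refine mul_le_mul_of_nonneg_left (mul_le_mul_of_nonneg_left ?_ (sq_nonneg _)) (sq_nonneg _)
  calc ∑ e ∈ boundary R a, u e.1 * v e.2
      ≤ #A * ∑ j, v j + (∑ i, u i) * #B := by
        rw [← sum_u, ← sum_v]
        exact sum_mul_le_of_subset_union_product boundary_subset u_nonneg v_nonneg
    _ ≤ #A * (#B + Fintype.card κ * q ^ 2) + (#A + Fintype.card ι * p ^ 2) * #B := by
        gcongr
        · exact sum_ite_mem_one_le_card_add B (sq_nonneg q)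
        · exact sum_ite_mem_one_le_card_add A (sq_nonneg p)

theorem sum_boundary_blockMoment_sq_le_of_mem_clusters {δ : ℝ} (hlam : lam ^ 2 ≤ δ)
    (hrow : lam ^ 2 * (Fintype.card ι * p ^ 2) ≤ δ)
    (hcol : lam ^ 2 * (Fintype.card κ * q ^ 2) ≤ δ) {z : ι} (ha : a ∈ clusters {z} k)
    (hk : k ≤ D) :
    ∑ e ∈ boundary {z} a, blockMoment lam p q {z} (insert e a) ^ 2 ≤
      blockMoment lam p q {z} a ^ 2 * (2 * (D + 1) ^ 2 * δ) := by
  have hδ : 0 ≤ δ := (sq_nonneg lam).trans hlam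
  have card_le : #a ≤ D := (card_of_mem_clusters ha).trans_le hk
  have rows : (#({z} ∪ a.image Prod.fst) : ℝ) ≤ D + 1 := by
    have h₁ := card_union_le {z} (a.image Prod.fst)
    have h₂ := card_image_le (s := a) (f := Prod.fst)
    rw [card_singleton] at h₁
    exact_mod_cast (by omega : #({z} ∪ a.image Prod.fst) ≤ D + 1)
  have columns : (#(a.image Prod.snd) : ℝ) ≤ D := by
    exact_mod_cast card_image_le.trans card_le
  refine (sum_boundary_blockMoment_sq_le {z} a).trans
    (mul_le_mul_of_nonneg_left ?_ (sq_nonneg _))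
  calc _ ≤ lam ^ 2 * (((D : ℝ) + 1) * (D + Fintype.card κ * q ^ 2) +
          (D + 1 + Fintype.card ι * p ^ 2) * D) := by gcongr
    _ = ((D : ℝ) + 1) * (D * lam ^ 2 + lam ^ 2 * (Fintype.card κ * q ^ 2)) +
          D * ((D + 1) * lam ^ 2 + lam ^ 2 * (Fintype.card ι * p ^ 2)) := by ring
    _ ≤ ((D : ℝ) + 1) * (D * δ + δ) + D * ((D + 1) * δ + δ) := by gcongr
    _ ≤ 2 * (D + 1) ^ 2 * δ := by linarith

theorem sum_clusters_blockMoment_sq_le {δ : ℝ} (hlam : lam ^ 2 ≤ δ)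
    (hrow : lam ^ 2 * (Fintype.card ι * p ^ 2) ≤ δ)
    (hcol : lam ^ 2 * (Fintype.card κ * q ^ 2) ≤ δ) (z : ι) (hk : k ≤ D) :
    ∑ a ∈ clusters (κ := κ) {z} k, blockMoment lam p q {z} a ^ 2 ≤
      p ^ 2 * (2 * (D + 1) ^ 2 * δ) ^ k := by
  have hδ : 0 ≤ δ := (sq_nonneg lam).trans hlam
  induction k with
  | zero => simp [clusters, blockMoment_empty]
  | succ k ih =>
    have hkD : k ≤ D := Nat.le_of_succ_le hk
    calc ∑ a ∈ clusters {z} (k + 1), blockMoment lam p q {z} a ^ 2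
        ≤ ∑ x ∈ (clusters {z} k).sigma (boundary {z}),
            blockMoment lam p q {z} (insert x.2 x.1) ^ 2 :=
          sum_image_le_of_nonneg fun _ _ => sq_nonneg _
      _ = ∑ a ∈ clusters {z} k, ∑ e ∈ boundary {z} a,
            blockMoment lam p q {z} (insert e a) ^ 2 := sum_sigma _ _ _
      _ ≤ (∑ a ∈ clusters {z} k, blockMoment lam p q {z} a ^ 2) * (2 * (D + 1) ^ 2 * δ) := by
          rw [sum_mul]
          exact sum_le_sum fun a ha =>
            sum_boundary_blockMoment_sq_le_of_mem_clusters hlam hrow hcol ha hkD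
      _ ≤ p ^ 2 * (2 * (D + 1) ^ 2 * δ) ^ (k + 1) := by
          rw [pow_succ _ k, ← mul_assoc (p ^ 2)]
          exact mul_le_mul_of_nonneg_right (ih hkD) (by positivity)

theorem sum_blockCumulant_sq_layer_le (hlam₀ : 0 ≤ lam) (hp : 0 ≤ p) (hp₁ : p ≤ 1) (hq : 0 ≤ q)
    (hq₁ : q ≤ 1) (hlam : lam ^ 2 ≤ (8 * ((D : ℝ) + 1) ^ 4)⁻¹)
    (hrow : lam ^ 2 * (Fintype.card ι * p ^ 2) ≤ (8 * ((D : ℝ) + 1) ^ 4)⁻¹)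
    (hcol : lam ^ 2 * (Fintype.card κ * q ^ 2) ≤ (8 * ((D : ℝ) + 1) ^ 4)⁻¹) (z : ι)
    (hk : k ≤ D) :
    ∑ a : Finset (ι × κ) with #a = k, blockCumulant lam p q {z} a ^ 2 * 2 ^ #a ≤
      p ^ 2 * (1 / 2) ^ k := by
  have cumulant_le : ∀ a ∈ clusters (κ := κ) {z} k, blockCumulant lam p q {z} a ^ 2 * 2 ^ #a ≤
      (2 * ((D : ℝ) + 1) ^ 2) ^ k * blockMoment lam p q {z} a ^ 2 := by
    intro a ha
    have moment_nonneg := blockMoment_nonneg hlam₀ hp hq {z} a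
    have habs := abs_blockCumulant_le hlam₀ hp hp₁ hq hq₁ {z} a
    rw [card_of_mem_clusters ha] at habs ⊢
    calc blockCumulant lam p q {z} a ^ 2 * 2 ^ k
        ≤ (((D : ℝ) + 1) ^ k * blockMoment lam p q {z} a) ^ 2 * 2 ^ k := by
          rw [← sq_abs (blockCumulant lam p q {z} a)]
          gcongr
          exact habs.trans (by gcongr)
      _ = (2 * ((D : ℝ) + 1) ^ 2) ^ k * blockMoment lam p q {z} a ^ 2 := by
          rw [mul_pow, mul_pow 2, ← pow_mul, ← pow_mul, mul_comm 2 k]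
          ring
  calc ∑ a : Finset (ι × κ) with #a = k, blockCumulant lam p q {z} a ^ 2 * 2 ^ #a
      ≤ ∑ a ∈ clusters {z} k, blockCumulant lam p q {z} a ^ 2 * 2 ^ #a := by
        rw [← sum_filter_ne_zero]
        refine sum_le_sum_of_subset_of_nonneg (fun a ha => ?_) fun a _ _ => by positivity
        simp only [mem_filter, mem_univ, true_and] at ha
        exact ha.1 ▸ mem_clusters_of_blockCumulant_ne_zero (lam := lam) (p := p) (q := q)
          fun h => ha.2 (by rw [h]; ring)
    _ ≤ (2 * ((D : ℝ) + 1) ^ 2) ^ k * ∑ a ∈ clusters {z} k, blockMoment lam p q {z} a ^ 2 := by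
        rw [mul_sum]
        exact sum_le_sum cumulant_le
    _ ≤ (2 * ((D : ℝ) + 1) ^ 2) ^ k *
          (p ^ 2 * (2 * ((D : ℝ) + 1) ^ 2 * (8 * ((D : ℝ) + 1) ^ 4)⁻¹) ^ k) := by
        gcongr
        exact sum_clusters_blockMoment_sq_le hlam hrow hcol z hk
    _ = p ^ 2 * (1 / 2) ^ k := by
        rw [mul_left_comm, ← mul_pow]
        congr 2
        field_simp
        norm_num

theorem sum_blockCumulant_sq_le (hlam₀ : 0 ≤ lam) (hp : 0 ≤ p) (hp₁ : p ≤ 1) (hq : 0 ≤ q)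
    (hq₁ : q ≤ 1) (hlam : lam ^ 2 ≤ (8 * ((D : ℝ) + 1) ^ 4)⁻¹)
    (hrow : lam ^ 2 * (Fintype.card ι * p ^ 2) ≤ (8 * ((D : ℝ) + 1) ^ 4)⁻¹)
    (hcol : lam ^ 2 * (Fintype.card κ * q ^ 2) ≤ (8 * ((D : ℝ) + 1) ^ 4)⁻¹) (z : ι) :
    ∑ a : Finset (ι × κ) with #a ≤ D, blockCumulant lam p q {z} a ^ 2 * 2 ^ #a ≤ 2 * p ^ 2 := by
  have maps_to : ∀ a ∈ ({a | #a ≤ D} : Finset (Finset (ι × κ))), #a ∈ range (D + 1) :=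
    fun a ha => mem_range_succ_iff.2 (mem_filter.1 ha).2
  calc ∑ a : Finset (ι × κ) with #a ≤ D, blockCumulant lam p q {z} a ^ 2 * 2 ^ #a
      = ∑ k ∈ range (D + 1), ∑ a ∈ ({a | #a ≤ D} : Finset (Finset (ι × κ))) with #a = k,
          blockCumulant lam p q {z} a ^ 2 * 2 ^ #a := (sum_fiberwise_of_maps_to maps_to _).symm
    _ ≤ ∑ k ∈ range (D + 1), p ^ 2 * (1 / 2) ^ k := by
        refine sum_le_sum fun k hk => le_trans ?_ (sum_blockCumulant_sq_layer_le hlam₀ hp hp₁ hq hq₁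
          hlam hrow hcol z (mem_range_succ_iff.1 hk))
        exact sum_le_sum_of_subset_of_nonneg (filter_subset_filter _ (subset_univ _))
          fun _ _ _ => by positivity
    _ ≤ 2 * p ^ 2 := by
        rw [← mul_sum, mul_comm]
        exact mul_le_mul_of_nonneg_right (sum_geometric_two_le _) (sq_nonneg p)

end Clusters

section Observation

variable {n d : ℕ} {M : Matrix (Fin n) (Fin d) ℝ}

/-- The expectation of `φ` under the law on `{-1, 1}` with mean `μ`. -/
noncomputable def entryMean (μ : ℝ) (φ : ℝ → ℝ) : ℝ :=
  (1 + μ) / 2 * φ 1 + (1 - μ) / 2 * φ (-1)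

/-- The conditional expectation, given `M`, of a function of the observed sign matrix. -/
noncomputable def signMean (M : Matrix (Fin n) (Fin d) ℝ) : (SignMatrix n d → ℝ) →ₗ[ℝ] ℝ :=
  ∑ Y, obsProb M Y • LinearMap.proj Y

/-- The centred entry, normalized to have conditional correlation `1` with the entry itself. -/
noncomputable def dualEntry (M : Matrix (Fin n) (Fin d) ℝ) (Y : SignMatrix n d)
    (e : Fin n × Fin d) : ℝ :=
  (entry Y e - M e.1 e.2) / (1 - M e.1 e.2 ^ 2)

/-- The multilinear monomial in the entries indexed by `a`. -/
def entryMonomial (a : Finset (Fin n × Fin d)) (Y : SignMatrix n d) : ℝ :=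
  ∏ e ∈ a, entry Y e

theorem signMean_apply (g : SignMatrix n d → ℝ) : signMean M g = ∑ Y, obsProb M Y * g Y := by
  simp [signMean]

theorem signMean_const (c : ℝ) : signMean M (fun _ => c) = c := by
  rw [signMean_apply, ← sum_mul, sum_obsProb, one_mul]

theorem signMean_const_mul (c : ℝ) (g : SignMatrix n d → ℝ) :
    signMean M (fun Y => c * g Y) = c * signMean M g :=
  map_smul (signMean M) c g

theorem signMean_nonneg (hM : ∀ i k, M i k ^ 2 ≤ 1) {g : SignMatrix n d → ℝ} (hg : ∀ Y, 0 ≤ g Y) :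
    0 ≤ signMean M g := by
  rw [signMean_apply]
  refine sum_nonneg fun Y _ => mul_nonneg (prod_nonneg fun e _ => ?_) (hg Y)
  have hMe := abs_le.1 ((sq_le_one_iff_abs_le_one _).1 (hM e.1 e.2))
  rcases Int.units_eq_one_or (Y e.1 e.2) with h | h <;> simp only [entry, h] <;> push_cast <;>
    linarith [hMe.1, hMe.2]

theorem signMean_prod (φ : Fin n × Fin d → ℝ → ℝ) :
    signMean M (fun Y => ∏ e, φ e (entry Y e)) = ∏ e, entryMean (M e.1 e.2) (φ e) := by
  have entryMean_eq_sum : ∀ e : Fin n × Fin d, entryMean (M e.1 e.2) (φ e) =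
      ∑ u : ℤˣ, (1 + ((u : ℤ) : ℝ) * M e.1 e.2) / 2 * φ e ((u : ℤ) : ℝ) := by
    intro e
    rw [entryMean, show (univ : Finset ℤˣ) = {1, -1} from rfl, sum_pair (by decide)]
    push_cast
    ring
  simp only [signMean_apply, entryMean_eq_sum, obsProb, ← prod_mul_distrib]
  rw [prod_univ_sum, Fintype.piFinset_univ, ← (Equiv.curry (Fin n) (Fin d) ℤˣ).sum_comp]
  rfl

theorem entryMean_centred_mul {μ : ℝ} (hμ : μ ^ 2 ≠ 1) (φ : ℝ → ℝ) :
    entryMean μ (fun y => (y - μ) / (1 - μ ^ 2) * φ y) = (φ 1 - φ (-1)) / 2 := by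
  have : 1 - μ ^ 2 ≠ 0 := sub_ne_zero.2 hμ.symm
  rw [entryMean]
  field_simp
  ring

/-- Multiplying by a dual entry differentiates in that entry, so that products of dual entries are
orthogonal to monomials that do not contain all of them. -/
theorem signMean_prod_dualEntry_mul_prod (hM : ∀ i k, M i k ^ 2 ≠ 1) (b : Finset (Fin n × Fin d))
    (φ : Fin n × Fin d → ℝ → ℝ) :
    signMean M (fun Y => (∏ e ∈ b, dualEntry M Y e) * ∏ e, φ e (entry Y e)) =
      ∏ e, if e ∈ b then (φ e 1 - φ e (-1)) / 2 else entryMean (M e.1 e.2) (φ e) := by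
  have key := signMean_prod (M := M) fun e y =>
    (if e ∈ b then (y - M e.1 e.2) / (1 - M e.1 e.2 ^ 2) else 1) * φ e y
  simp only [prod_mul_distrib, Fintype.prod_ite_mem] at key
  refine key.trans (prod_congr rfl fun e _ => ?_)
  split_ifs
  · exact entryMean_centred_mul (hM _ _) (φ e)
  · simp only [one_mul]

theorem signMean_entryMonomial (a : Finset (Fin n × Fin d)) :
    signMean M (entryMonomial a) = ∏ e ∈ a, M e.1 e.2 := by
  have key := signMean_prod (M := M) fun e y => if e ∈ a then y else 1
  simp only [Fintype.prod_ite_mem] at key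
  refine key.trans ?_
  rw [← Fintype.prod_ite_mem a]
  refine prod_congr rfl fun e _ => ?_
  rw [entryMean]
  split_ifs <;> ring

theorem signMean_prod_dualEntry_mul_entryMonomial (hM : ∀ i k, M i k ^ 2 ≠ 1)
    (b a : Finset (Fin n × Fin d)) :
    signMean M (fun Y => (∏ e ∈ b, dualEntry M Y e) * entryMonomial a Y) =
      if b ⊆ a then ∏ e ∈ a \ b, M e.1 e.2 else 0 := by
  have key := signMean_prod_dualEntry_mul_prod hM b fun e y => if e ∈ a then y else 1
  simp only [Fintype.prod_ite_mem] at key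
  refine key.trans ?_
  split_ifs with hba
  · rw [← Fintype.prod_ite_mem (a \ b)]
    refine prod_congr rfl fun e _ => ?_
    by_cases hb : e ∈ b
    · simp [hb, hba hb]
    · by_cases ha : e ∈ a <;> simp only [ha, hb, mem_sdiff, entryMean, if_true, if_false,
        not_false_iff, and_true] <;> ring
  · obtain ⟨e, hb, ha⟩ := not_subset.1 hba
    exact prod_eq_zero (mem_univ e) (by simp [ha, hb])

theorem signMean_prod_dualEntry_mul_prod_dualEntry (hM : ∀ i k, M i k ^ 2 ≠ 1)
    (b a : Finset (Fin n × Fin d)) :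
    signMean M (fun Y => (∏ e ∈ b, dualEntry M Y e) * ∏ e ∈ a, dualEntry M Y e) =
      if b = a then ∏ e ∈ b, (1 - M e.1 e.2 ^ 2)⁻¹ else 0 := by
  have key := signMean_prod_dualEntry_mul_prod hM b fun e y =>
    if e ∈ a then (y - M e.1 e.2) / (1 - M e.1 e.2 ^ 2) else 1
  simp only [Fintype.prod_ite_mem] at key
  refine key.trans ?_
  split_ifs with hba
  · subst hba
    rw [← Fintype.prod_ite_mem b]
    refine prod_congr rfl fun e _ => ?_
    by_cases hb : e ∈ b <;> simp only [hb, entryMean, if_true, if_false] <;> ring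
  · obtain ⟨e, he⟩ : ∃ e, ¬(e ∈ b ↔ e ∈ a) := not_forall.1 fun h => hba (Finset.ext h)
    refine prod_eq_zero (mem_univ e) ?_
    by_cases hb : e ∈ b <;> by_cases ha : e ∈ a <;> simp only [ha, hb, if_true, if_false]
    · simp [ha, hb] at he
    · ring
    · simpa using entryMean_centred_mul (hM e.1 e.2) fun _ => 1
    · simp [ha, hb] at he

theorem entry_pow (Y : SignMatrix n d) (e : Fin n × Fin d) (k : ℕ) :
    entry Y e ^ k = if Odd k then entry Y e else 1 := by
  rcases Int.units_eq_one_or (Y e.1 e.2) with h | h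
  · simp [entry, h]
  · split_ifs with hk
    · simp [entry, h, hk.neg_one_pow]
    · simp [entry, h, (Nat.not_odd_iff_even.1 hk).neg_one_pow]

theorem polyValue_eq_sum_entryMonomial (f : MvPolynomial (Fin n × Fin d) ℝ) :
    polyValue f = ∑ s ∈ f.support, f.coeff s • entryMonomial {e ∈ s.support | Odd (s e)} := by
  ext Y
  simp only [polyValue, MvPolynomial.eval_eq, Finset.sum_apply, Pi.smul_apply, smul_eq_mul,
    entryMonomial, prod_filter, entry_pow]

theorem card_filter_odd_le_totalDegree {σ R : Type*} [CommSemiring R] {f : MvPolynomial σ R}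
    {s : σ →₀ ℕ} (hs : s ∈ f.support) : #{e ∈ s.support | Odd (s e)} ≤ f.totalDegree := by
  refine (card_filter_le _ _).trans (le_trans ?_ (MvPolynomial.le_totalDegree hs))
  rw [card_eq_sum_ones]
  exact sum_le_sum fun e he => Nat.one_le_iff_ne_zero.2 (Finsupp.mem_support_iff.1 he)

end Observation

section Duality

variable {A F R : Type*} [CommRing A] [CommRing R] [LinearOrder R] [IsStrictOrderedRing R]
  [FunLike F A R] [AddMonoidHomClass F A R] {L : F}

theorem map_sq_sub_map_sq_le_map_sub_sq (hL : ∀ u, 0 ≤ L (u ^ 2)) {f x W : A}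
    (hW : L (W * f) = L (x * f)) : L (x ^ 2) - L (W ^ 2) ≤ L ((f - x) ^ 2) := by
  have expand : ∀ g, L ((f - g) ^ 2) = L (f ^ 2) - (L (g * f) + L (g * f)) + L (g ^ 2) := by
    intro g
    rw [← map_add, ← map_sub, ← map_add]
    congr 1
    ring
  have nonneg := hL (f - W)
  rw [expand, hW] at nonneg
  rw [expand]
  linarith

theorem map_sub_sq_le (hL : ∀ u, 0 ≤ L (u ^ 2)) (f g : A) :
    L ((f - g) ^ 2) ≤ 2 * L (f ^ 2) + 2 * L (g ^ 2) := by
  have parallelogram : L ((f - g) ^ 2) + L ((f + g) ^ 2) =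
      (L (f ^ 2) + L (f ^ 2)) + (L (g ^ 2) + L (g ^ 2)) := by
    simp only [← map_add]
    congr 1
    ring
  linarith [hL (f + g)]

end Duality

section Certificate

variable {Ω : Type*} [Fintype Ω] {n d D : ℕ} {w x : Ω → ℝ} {M : Ω → Matrix (Fin n) (Fin d) ℝ}

/-- The expectation of a function of `(ω, Y)`, where `ω` has law `w` and the sign matrix `Y` is
observed given `M ω`. -/
noncomputable def jointMean (w : Ω → ℝ) (M : Ω → Matrix (Fin n) (Fin d) ℝ) :
    (Ω × SignMatrix n d → ℝ) →ₗ[ℝ] ℝ :=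
  ∑ ω, w ω • (signMean (M ω) ∘ₗ LinearMap.funLeft ℝ ℝ (Prod.mk ω))

/-- The moment `𝔼[x * ∏ (i, k) ∈ a, M i k]`. -/
def priorMoment (w x : Ω → ℝ) (M : Ω → Matrix (Fin n) (Fin d) ℝ)
    (a : Finset (Fin n × Fin d)) : ℝ :=
  ∑ ω, w ω * (x ω * ∏ e ∈ a, M ω e.1 e.2)

/-- The product of the dual entries indexed by `b`. -/
noncomputable def dualMonomial (M : Ω → Matrix (Fin n) (Fin d) ℝ) (b : Finset (Fin n × Fin d)) :
    Ω × SignMatrix n d → ℝ :=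
  fun ω => ∏ e ∈ b, dualEntry (M ω.1) ω.2 e

/-- The dual certificate: a random variable with the same correlation as `x` with every polynomial
of degree at most `D` in the observation. -/
noncomputable def certificate (D : ℕ) (w x : Ω → ℝ) (M : Ω → Matrix (Fin n) (Fin d) ℝ) :
    Ω × SignMatrix n d → ℝ :=
  ∑ b with #b ≤ D, relativeCumulant (priorMoment w x M) (priorMoment w 1 M) b • dualMonomial M b

theorem jointMean_apply (g : Ω × SignMatrix n d → ℝ) :
    jointMean w M g = ∑ ω, w ω * signMean (M ω) fun Y => g (ω, Y) := by
  simp only [jointMean, LinearMap.sum_apply, LinearMap.smul_apply, smul_eq_mul]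
  rfl

theorem jointMean_comp_fst (x : Ω → ℝ) : jointMean w M (x ∘ Prod.fst) = ∑ ω, w ω * x ω := by
  simp only [jointMean_apply, Function.comp_apply, signMean_const]

theorem jointMean_nonneg (hw : ∀ ω, 0 ≤ w ω) (hM : ∀ ω i k, M ω i k ^ 2 ≤ 1)
    {g : Ω × SignMatrix n d → ℝ} (hg : ∀ ω, 0 ≤ g ω) : 0 ≤ jointMean w M g := by
  rw [jointMean_apply]
  exact sum_nonneg fun ω _ => mul_nonneg (hw ω) (signMean_nonneg (hM ω) fun Y => hg (ω, Y))

theorem jointMean_mul_entryMonomial (a : Finset (Fin n × Fin d)) :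
    jointMean w M (x ∘ Prod.fst * entryMonomial a ∘ Prod.snd) = priorMoment w x M a := by
  rw [jointMean_apply]
  refine sum_congr rfl fun ω _ => ?_
  rw [← signMean_entryMonomial a, ← signMean_const_mul (x ω)]
  rfl

theorem jointMean_dualMonomial_mul_entryMonomial (hM : ∀ ω i k, M ω i k ^ 2 ≠ 1)
    (b a : Finset (Fin n × Fin d)) :
    jointMean w M (dualMonomial M b * entryMonomial a ∘ Prod.snd) =
      if b ⊆ a then priorMoment w 1 M (a \ b) else 0 := by
  have conditional : ∀ ω, signMean (M ω)
      (fun Y => (dualMonomial M b * entryMonomial a ∘ Prod.snd : Ω × _ → ℝ) (ω, Y)) = _ :=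
    fun ω => signMean_prod_dualEntry_mul_entryMonomial (hM ω) b a
  simp only [jointMean_apply, conditional, priorMoment, Pi.one_apply, one_mul]
  split_ifs
  · rfl
  · simp only [mul_zero, sum_const_zero]

theorem jointMean_dualMonomial_mul_dualMonomial (hM : ∀ ω i k, M ω i k ^ 2 ≠ 1)
    (b a : Finset (Fin n × Fin d)) :
    jointMean w M (dualMonomial M b * dualMonomial M a) =
      if b = a then ∑ ω, w ω * ∏ e ∈ b, (1 - M ω e.1 e.2 ^ 2)⁻¹ else 0 := by
  have conditional : ∀ ω, signMean (M ω)
      (fun Y => (dualMonomial M b * dualMonomial M a) (ω, Y)) = _ :=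
    fun ω => signMean_prod_dualEntry_mul_prod_dualEntry (hM ω) b a
  simp only [jointMean_apply, conditional]
  split_ifs
  · rfl
  · simp only [mul_zero, sum_const_zero]

theorem jointMean_certificate_mul (g : Ω × SignMatrix n d → ℝ) :
    jointMean w M (certificate D w x M * g) =
      ∑ b with #b ≤ D, relativeCumulant (priorMoment w x M) (priorMoment w 1 M) b *
        jointMean w M (dualMonomial M b * g) := by
  simp only [certificate, sum_mul, smul_mul_assoc, map_sum, map_smul, smul_eq_mul]

theorem jointMean_certificate_mul_entryMonomial (hw : ∑ ω, w ω = 1)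
    (hM : ∀ ω i k, M ω i k ^ 2 ≠ 1) {a : Finset (Fin n × Fin d)} (ha : #a ≤ D) :
    jointMean w M (certificate D w x M * entryMonomial a ∘ Prod.snd) =
      jointMean w M (x ∘ Prod.fst * entryMonomial a ∘ Prod.snd) := by
  have moment_empty : priorMoment w 1 M ∅ = 1 := by simpa [priorMoment] using hw
  have subsets : (({b | #b ≤ D} : Finset (Finset (Fin n × Fin d))).filter (· ⊆ a)) =
      a.powerset := by
    ext b
    simp only [mem_filter, mem_univ, true_and, mem_powerset]
    exact ⟨And.right, fun h => ⟨(card_le_card h).trans ha, h⟩⟩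
  rw [jointMean_mul_entryMonomial, jointMean_certificate_mul]
  simp only [jointMean_dualMonomial_mul_entryMonomial hM, mul_ite, mul_zero]
  rw [← sum_filter, subsets, sum_powerset_relativeCumulant_mul moment_empty]

theorem jointMean_certificate_mul_polyValue (hw : ∑ ω, w ω = 1) (hM : ∀ ω i k, M ω i k ^ 2 ≠ 1)
    {f : MvPolynomial (Fin n × Fin d) ℝ} (hf : f.totalDegree ≤ D) :
    jointMean w M (certificate D w x M * polyValue f ∘ Prod.snd) =
      jointMean w M (x ∘ Prod.fst * polyValue f ∘ Prod.snd) := by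
  have expand : polyValue f ∘ Prod.snd = ∑ s ∈ f.support,
      f.coeff s • (entryMonomial {e ∈ s.support | Odd (s e)} ∘ Prod.snd : Ω × _ → ℝ) := by
    rw [polyValue_eq_sum_entryMonomial]
    ext ω
    simp
  simp only [expand, mul_sum, mul_smul_comm, map_sum, map_smul]
  refine sum_congr rfl fun s hs => ?_
  rw [jointMean_certificate_mul_entryMonomial hw hM ((card_filter_odd_le_totalDegree hs).trans hf)]

theorem jointMean_certificate_sq_le (hw₀ : ∀ ω, 0 ≤ w ω) (hw : ∑ ω, w ω = 1)
    (hM : ∀ ω i k, M ω i k ^ 2 ≤ 1 / 2) :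
    jointMean w M (certificate D w x M ^ 2) ≤ ∑ b with #b ≤ D,
      relativeCumulant (priorMoment w x M) (priorMoment w 1 M) b ^ 2 * 2 ^ #b := by
  have hM_ne : ∀ ω i k, M ω i k ^ 2 ≠ 1 := fun ω i k =>
    ((hM ω i k).trans_lt one_half_lt_one).ne
  have norm_sq_le : ∀ b : Finset (Fin n × Fin d), ∑ ω, w ω * ∏ e ∈ b, (1 - M ω e.1 e.2 ^ 2)⁻¹ ≤
      2 ^ #b := by
    intro b
    have inv_le : ∀ ω (e : Fin n × Fin d), (1 - M ω e.1 e.2 ^ 2)⁻¹ ≤ 2 := fun ω e =>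
      inv_le_of_inv_le₀ two_pos (by linarith [hM ω e.1 e.2])
    calc ∑ ω, w ω * ∏ e ∈ b, (1 - M ω e.1 e.2 ^ 2)⁻¹ ≤ ∑ ω, w ω * 2 ^ #b := by
          refine sum_le_sum fun ω _ => mul_le_mul_of_nonneg_left ?_ (hw₀ ω)
          rw [← prod_const]
          exact prod_le_prod (fun e _ => inv_nonneg.2 (by linarith [hM ω e.1 e.2]))
            fun e _ => inv_le ω e
      _ = 2 ^ #b := by rw [← sum_mul, hw, one_mul]
  rw [sq, jointMean_certificate_mul]
  refine sum_le_sum fun b hb => ?_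
  rw [mul_comm (dualMonomial M b), jointMean_certificate_mul]
  simp only [jointMean_dualMonomial_mul_dualMonomial hM_ne, mul_ite, mul_zero, sum_ite_eq', hb,
    if_true]
  rw [← mul_assoc, ← sq]
  exact mul_le_mul_of_nonneg_left (norm_sq_le b) (sq_nonneg _)

end Certificate

section BlockModel

variable {n d D : ℕ} {lam p q : ℝ}

theorem sum_prod_ite_mem {ι R : Type*} [Fintype ι] [DecidableEq ι] [CommSemiring R] (f g : ι → R) :
    ∑ S : Finset ι, ∏ i, (if i ∈ S then f i else g i) = ∏ i, (f i + g i) := by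
  rw [Fintype.prod_add]
  refine sum_congr rfl fun S _ => ?_
  rw [prod_ite, filter_mem_eq_inter, univ_inter, ← compl_filter, filter_mem_eq_inter, univ_inter]

theorem sum_subsetProb_mul_ite_subset {m : ℕ} (p : ℝ) (A : Finset (Fin m)) :
    ∑ S, subsetProb p S * (if A ⊆ S then 1 else 0) = p ^ #A := by
  have restrict : ∀ S : Finset (Fin m), subsetProb p S * (if A ⊆ S then 1 else 0) =
      ∏ i, if i ∈ S then p else if i ∈ A then 0 else 1 - p := by
    intro S
    split_ifs with hAS
    · rw [mul_one]
      refine prod_congr rfl fun i _ => ?_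
      by_cases hS : i ∈ S
      · simp only [hS, if_true]
      · have hA : i ∉ A := fun hA => hS (hAS hA)
        simp only [hS, hA, if_false]
    · obtain ⟨i, hA, hS⟩ := not_subset.1 hAS
      rw [mul_zero, prod_eq_zero (mem_univ i) (by simp only [hS, hA, if_true, if_false])]
  rw [sum_congr rfl fun S _ => restrict S, sum_prod_ite_mem, ← prod_const, ← Fintype.prod_ite_mem A]
  exact prod_congr rfl fun i _ => by split_ifs <;> ring

theorem subsetProb_nonneg (hp : 0 ≤ p) (hp₁ : p ≤ 1) (S : Finset (Fin n)) : 0 ≤ subsetProb p S :=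
  prod_nonneg fun _ _ => ite_nonneg hp (sub_nonneg.2 hp₁)

theorem prod_blockMatrix (S : Finset (Fin n)) (T : Finset (Fin d)) (a : Finset (Fin n × Fin d)) :
    ∏ e ∈ a, blockMatrix lam S T e.1 e.2 = lam ^ #a *
      ((if a.image Prod.fst ⊆ S then 1 else 0) * (if a.image Prod.snd ⊆ T then 1 else 0)) := by
  have mem_block : (∀ e ∈ a, e.1 ∈ S ∧ e.2 ∈ T) ↔ a.image Prod.fst ⊆ S ∧ a.image Prod.snd ⊆ T := by
    simp only [image_subset_iff, forall_and]
  simp only [blockMatrix, prod_ite_zero, mem_block, prod_const]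
  rw [ite_zero_mul_ite_zero, one_mul, mul_ite, mul_one, mul_zero]

theorem blockMatrix_sq_le (S : Finset (Fin n)) (T : Finset (Fin d)) (i : Fin n) (k : Fin d) :
    blockMatrix lam S T i k ^ 2 ≤ lam ^ 2 := by
  unfold blockMatrix
  split_ifs
  · exact le_rfl
  · simpa using sq_nonneg lam

/-- The law of the hidden rows and columns `(S, T)`. -/
def blockPrior (p q : ℝ) (ω : Finset (Fin n) × Finset (Fin d)) : ℝ :=
  subsetProb p ω.1 * subsetProb q ω.2

/-- The expectation of a function of `((S, T), Y)` in the hidden block model with arbitrary real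
selection probabilities `p` for the rows and `q` for the columns. -/
noncomputable def blockExpectation (lam p q : ℝ) :
    ((Finset (Fin n) × Finset (Fin d)) × SignMatrix n d → ℝ) →ₗ[ℝ] ℝ :=
  jointMean (blockPrior p q) fun ω => blockMatrix lam ω.1 ω.2

/-- The dual certificate of the hidden block model for the target `1{z ∈ S}`. -/
noncomputable def blockCertificate (D : ℕ) (lam p q : ℝ) (z : Fin n) :
    (Finset (Fin n) × Finset (Fin d)) × SignMatrix n d → ℝ :=
  certificate D (blockPrior p q) (fun ω => rowSelected ω.1 z) fun ω => blockMatrix lam ω.1 ω.2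

/-- The indicator that no column is selected. -/
def noColumn (T : Finset (Fin d)) : ℝ := if T = ∅ then 1 else 0

/-- The dual certificate of the hidden block model for the target `1{z ∈ S, T ≠ ∅}`. If `T = ∅`
then `Y` is independent of `S`, so that `p * 1{T = ∅}` has the same correlation as
`1{z ∈ S, T = ∅}` with every function of `Y`. -/
noncomputable def positiveCertificate (D : ℕ) (lam p q : ℝ) (z : Fin n) :
    (Finset (Fin n) × Finset (Fin d)) × SignMatrix n d → ℝ :=
  blockCertificate D lam p q z - fun ω => p * noColumn ω.1.2

theorem expectation_eq_blockExpectation (Kn Kd : ℕ)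
    (g : Finset (Fin n) → Finset (Fin d) → SignMatrix n d → ℝ) :
    expectation n d lam Kn Kd g =
      blockExpectation lam ((Kn : ℝ) / n) ((Kd : ℝ) / d) fun ω => g ω.1.1 ω.1.2 ω.2 := by
  simp only [expectation, blockExpectation, jointMean_apply, signMean_apply, jointProb, blockPrior,
    Fintype.sum_prod_type, mul_sum, mul_assoc]

theorem sum_blockPrior_mul (u : Finset (Fin n) → ℝ) (v : Finset (Fin d) → ℝ) :
    ∑ ω, blockPrior p q ω * (u ω.1 * v ω.2) =
      (∑ S, subsetProb p S * u S) * ∑ T, subsetProb q T * v T := by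
  simp only [Fintype.sum_prod_type, sum_mul_sum, blockPrior, mul_mul_mul_comm]

theorem sum_blockPrior : ∑ ω : Finset (Fin n) × Finset (Fin d), blockPrior p q ω = 1 := by
  simp only [blockPrior, Fintype.sum_prod_type, ← mul_sum, sum_subsetProb, mul_one]

theorem priorMoment_blockPrior (R : Finset (Fin n)) :
    priorMoment (blockPrior p q) (fun ω => if R ⊆ ω.1 then 1 else 0)
      (fun ω : _ × Finset (Fin d) => blockMatrix lam ω.1 ω.2) = blockMoment lam p q R := by
  ext a
  have factor : ∀ ω : Finset (Fin n) × Finset (Fin d),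
      (if R ⊆ ω.1 then 1 else 0) * ∏ e ∈ a, blockMatrix lam ω.1 ω.2 e.1 e.2 = lam ^ #a *
        ((if R ∪ a.image Prod.fst ⊆ ω.1 then 1 else 0) *
          if a.image Prod.snd ⊆ ω.2 then 1 else 0) := by
    intro ω
    rw [prod_blockMatrix, mul_left_comm, ← mul_assoc (ite _ _ _)]
    simp only [union_subset_iff, ite_and, ite_mul, one_mul, zero_mul]
  simp only [priorMoment, factor, mul_left_comm _ (lam ^ #a), ← mul_sum]
  rw [sum_blockPrior_mul (fun S => if R ∪ a.image Prod.fst ⊆ S then 1 else 0)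
    (fun T => if a.image Prod.snd ⊆ T then 1 else 0), sum_subsetProb_mul_ite_subset,
    sum_subsetProb_mul_ite_subset, blockMoment, mul_assoc]

theorem relativeCumulant_blockPrior (z : Fin n) :
    relativeCumulant
      (priorMoment (blockPrior p q) (fun ω => rowSelected ω.1 z)
        fun ω : _ × Finset (Fin d) => blockMatrix lam ω.1 ω.2)
      (priorMoment (blockPrior p q) 1 fun ω => blockMatrix lam ω.1 ω.2) =
    blockCumulant lam p q {z} := by
  have target := priorMoment_blockPrior (d := d) (lam := lam) (p := p) (q := q) {z}
  have unit := priorMoment_blockPrior (d := d) (lam := lam) (p := p) (q := q) (∅ : Finset (Fin n))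
  simp only [singleton_subset_iff] at target
  simp only [empty_subset, if_true] at unit
  rw [blockCumulant, ← target, ← unit]
  rfl

theorem rowSelected_sq (S : Finset (Fin n)) (z : Fin n) :
    rowSelected S z ^ 2 = rowSelected S z := by
  rw [rowSelected, ite_pow, one_pow, zero_pow two_ne_zero]

theorem noColumn_sq (T : Finset (Fin d)) : noColumn T ^ 2 = noColumn T := by
  rw [noColumn, ite_pow, one_pow, zero_pow two_ne_zero]

theorem sum_subsetProb_mul_rowSelected (p : ℝ) (z : Fin n) :
    ∑ S, subsetProb p S * rowSelected S z = p := by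
  simpa [rowSelected] using sum_subsetProb_mul_ite_subset p {z}

theorem sum_subsetProb_mul_noColumn (q : ℝ) :
    ∑ T : Finset (Fin d), subsetProb q T * noColumn T = (1 - q) ^ d := by
  simp [noColumn, subsetProb]

theorem rowPositive_blockMatrix (hlam : 0 < lam) (S : Finset (Fin n)) (T : Finset (Fin d))
    (z : Fin n) :
    rowPositive (blockMatrix lam S T) z = rowSelected S z * (1 - noColumn T) := by
  have entry_pos : ∀ k, 0 < blockMatrix lam S T z k ↔ z ∈ S ∧ k ∈ T := fun k => by
    unfold blockMatrix
    split_ifs with h <;> simp [h, hlam]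
  simp only [rowPositive, entry_pos, exists_and_left, rowSelected, noColumn,
    ← not_nonempty_iff_eq_empty, Finset.Nonempty]
  by_cases hz : z ∈ S <;> by_cases hT : ∃ k, k ∈ T <;> simp [hz, hT]

theorem rowPositive_zero (z : Fin n) : rowPositive (0 : Matrix (Fin n) (Fin d) ℝ) z = 0 := by
  simp [rowPositive]

theorem blockMatrix_zero (S : Finset (Fin n)) (T : Finset (Fin d)) : blockMatrix 0 S T = 0 := by
  ext
  simp [blockMatrix]

theorem blockMatrix_empty (S : Finset (Fin n)) : blockMatrix lam S (∅ : Finset (Fin d)) = 0 := by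
  ext
  simp [blockMatrix]

theorem blockExpectation_comp_fst (u : Finset (Fin n) → ℝ) (v : Finset (Fin d) → ℝ) :
    blockExpectation lam p q (fun ω => u ω.1.1 * v ω.1.2) =
      (∑ S, subsetProb p S * u S) * ∑ T, subsetProb q T * v T := by
  rw [← sum_blockPrior_mul]
  exact jointMean_comp_fst fun ω : Finset (Fin n) × Finset (Fin d) => u ω.1 * v ω.2

theorem blockExpectation_rowSelected_sq (z : Fin n) :
    blockExpectation (d := d) lam p q (fun ω => rowSelected ω.1.1 z ^ 2) = p := by
  have key := blockExpectation_comp_fst (lam := lam) (p := p) (q := q)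
    (fun S : Finset (Fin n) => rowSelected S z) fun _ : Finset (Fin d) => 1
  simpa only [rowSelected_sq, mul_one, sum_subsetProb, sum_subsetProb_mul_rowSelected] using key

theorem blockExpectation_rowPositive_sq (hlam : 0 < lam) (z : Fin n) :
    blockExpectation (d := d) lam p q
        (fun ω => rowPositive (blockMatrix lam ω.1.1 ω.1.2) z ^ 2) =
      p * (1 - (1 - q) ^ d) := by
  have hsq : ∀ T : Finset (Fin d), (1 - noColumn T) ^ 2 = 1 - noColumn T := fun T => by
    linear_combination noColumn_sq T
  simp only [rowPositive_blockMatrix hlam, mul_pow, rowSelected_sq, hsq]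
  rw [blockExpectation_comp_fst (fun S => rowSelected S z) (fun T => 1 - noColumn T),
    sum_subsetProb_mul_rowSelected]
  simp only [mul_sub, mul_one, sum_sub_distrib, sum_subsetProb, sum_subsetProb_mul_noColumn]

theorem blockExpectation_mul_noColumn_mul (u : Finset (Fin n) → ℝ) (g : SignMatrix n d → ℝ) :
    blockExpectation lam p q (fun ω => u ω.1.1 * noColumn ω.1.2 * g ω.2) =
      (∑ S, subsetProb p S * u S) * ((1 - q) ^ d * signMean 0 g) := by
  have conditional : ∀ ω : Finset (Fin n) × Finset (Fin d),
      signMean (blockMatrix lam ω.1 ω.2) (fun Y => u ω.1 * noColumn ω.2 * g Y) =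
        u ω.1 * (noColumn ω.2 * signMean 0 g) := by
    rintro ⟨S, T⟩
    rw [signMean_const_mul, mul_assoc]
    rcases eq_or_ne T ∅ with rfl | hT
    · rw [blockMatrix_empty]
    · simp only [noColumn, hT, if_false, zero_mul]
  rw [blockExpectation, jointMean_apply]
  simp only [conditional]
  rw [sum_blockPrior_mul u fun T => noColumn T * signMean 0 g]
  simp only [← mul_assoc (subsetProb q _), ← sum_mul, sum_subsetProb_mul_noColumn]

end BlockModel

section LowSignal

variable {n d D : ℕ} {lam p q : ℝ}

/-- The parameters of the hidden block model lie in the regime where polynomials of degree at most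
`D` fail: rows are rarely selected, and each single entry, row and column of the block carries
little signal. -/
structure LowSignal (n d D : ℕ) (lam p q : ℝ) : Prop where
  lam_nonneg : 0 ≤ lam
  row_nonneg : 0 ≤ p
  row_le : p ≤ 1 / 20
  col_nonneg : 0 ≤ q
  col_le_one : q ≤ 1
  entry_signal_le : lam ^ 2 ≤ (8 * ((D : ℝ) + 1) ^ 4)⁻¹
  row_signal_le : lam ^ 2 * (n * p ^ 2) ≤ (8 * ((D : ℝ) + 1) ^ 4)⁻¹
  col_signal_le : lam ^ 2 * (d * q ^ 2) ≤ (8 * ((D : ℝ) + 1) ^ 4)⁻¹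

namespace LowSignal

theorem row_le_one (h : LowSignal n d D lam p q) : p ≤ 1 := by linarith [h.row_le]

theorem lam_sq_le_half (h : LowSignal n d D lam p q) : lam ^ 2 ≤ 1 / 2 := by
  refine h.entry_signal_le.trans (inv_le_of_inv_le₀ (by norm_num) ?_)
  have : (1 : ℝ) ≤ ((D : ℝ) + 1) ^ 4 := one_le_pow₀ (by simp)
  linarith

theorem blockMatrix_sq_le_half (h : LowSignal n d D lam p q)
    (ω : Finset (Fin n) × Finset (Fin d)) (i : Fin n) (k : Fin d) :
    blockMatrix lam ω.1 ω.2 i k ^ 2 ≤ 1 / 2 :=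
  (blockMatrix_sq_le ω.1 ω.2 i k).trans h.lam_sq_le_half

theorem blockPrior_nonneg (h : LowSignal n d D lam p q) (ω : Finset (Fin n) × Finset (Fin d)) :
    0 ≤ blockPrior p q ω :=
  mul_nonneg (subsetProb_nonneg h.row_nonneg h.row_le_one _)
    (subsetProb_nonneg h.col_nonneg h.col_le_one _)

theorem blockExpectation_sq_nonneg (h : LowSignal n d D lam p q)
    (g : (Finset (Fin n) × Finset (Fin d)) × SignMatrix n d → ℝ) :
    0 ≤ blockExpectation lam p q (g ^ 2) :=
  jointMean_nonneg h.blockPrior_nonneg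
    (fun ω i k => (h.blockMatrix_sq_le_half ω i k).trans one_half_lt_one.le) fun _ => sq_nonneg _

theorem blockExpectation_blockCertificate_mul_polyValue (h : LowSignal n d D lam p q) (z : Fin n)
    {f : MvPolynomial (Fin n × Fin d) ℝ} (hf : f.totalDegree ≤ D) :
    blockExpectation lam p q (blockCertificate D lam p q z * polyValue f ∘ Prod.snd) =
      blockExpectation lam p q (fun ω => rowSelected ω.1.1 z * polyValue f ω.2) :=
  jointMean_certificate_mul_polyValue sum_blockPrior
    (fun ω i k => ((h.blockMatrix_sq_le_half ω i k).trans_lt one_half_lt_one).ne) hf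

theorem blockExpectation_blockCertificate_sq_le (h : LowSignal n d D lam p q) (z : Fin n) :
    blockExpectation (d := d) lam p q (blockCertificate D lam p q z ^ 2) ≤ 2 * p ^ 2 := by
  have sum_le := jointMean_certificate_sq_le (D := D) (x := fun ω => rowSelected ω.1 z)
    h.blockPrior_nonneg sum_blockPrior h.blockMatrix_sq_le_half
  rw [relativeCumulant_blockPrior] at sum_le
  exact sum_le.trans (sum_blockCumulant_sq_le h.lam_nonneg h.row_nonneg h.row_le_one h.col_nonneg
    h.col_le_one h.entry_signal_le (by simpa using h.row_signal_le)
    (by simpa using h.col_signal_le) z)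

theorem half_rowSelected_sq_le (h : LowSignal n d D lam p q) (z : Fin n)
    {f : MvPolynomial (Fin n × Fin d) ℝ} (hf : f.totalDegree ≤ D) :
    blockExpectation (d := d) lam p q (fun ω => rowSelected ω.1.1 z ^ 2) / 2 ≤
      blockExpectation lam p q (fun ω => (polyValue f ω.2 - rowSelected ω.1.1 z) ^ 2) := by
  have dual_bound : blockExpectation lam p q (fun ω => rowSelected ω.1.1 z ^ 2) -
      blockExpectation lam p q (blockCertificate D lam p q z ^ 2) ≤
        blockExpectation lam p q (fun ω => (polyValue f ω.2 - rowSelected ω.1.1 z) ^ 2) :=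
    map_sq_sub_map_sq_le_map_sub_sq h.blockExpectation_sq_nonneg
      (h.blockExpectation_blockCertificate_mul_polyValue z hf)
  have certificate_le := h.blockExpectation_blockCertificate_sq_le z
  rw [blockExpectation_rowSelected_sq] at dual_bound ⊢
  nlinarith [h.row_nonneg, h.row_le]

theorem blockExpectation_positiveCertificate_mul_polyValue (h : LowSignal n d D lam p q)
    (hlam : 0 < lam) (z : Fin n) {f : MvPolynomial (Fin n × Fin d) ℝ} (hf : f.totalDegree ≤ D) :
    blockExpectation lam p q (positiveCertificate D lam p q z * polyValue f ∘ Prod.snd) =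
      blockExpectation lam p q
        (fun ω => rowPositive (blockMatrix lam ω.1.1 ω.1.2) z * polyValue f ω.2) := by
  have target_eq : (fun ω : (Finset (Fin n) × Finset (Fin d)) × SignMatrix n d =>
        rowPositive (blockMatrix lam ω.1.1 ω.1.2) z * polyValue f ω.2) =
      (fun ω => rowSelected ω.1.1 z * polyValue f ω.2) -
        fun ω => rowSelected ω.1.1 z * noColumn ω.1.2 * polyValue f ω.2 := by
    ext ω
    rw [rowPositive_blockMatrix hlam, Pi.sub_apply]
    ring
  have noColumn_independent :
      blockExpectation lam p q (fun ω => rowSelected ω.1.1 z * noColumn ω.1.2 * polyValue f ω.2) =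
        blockExpectation lam p q (fun ω => p * noColumn ω.1.2 * polyValue f ω.2) := by
    rw [blockExpectation_mul_noColumn_mul (fun S => rowSelected S z),
      blockExpectation_mul_noColumn_mul fun _ : Finset (Fin n) => p,
      sum_subsetProb_mul_rowSelected, ← sum_mul, sum_subsetProb, one_mul]
  rw [target_eq, positiveCertificate, sub_mul, map_sub, map_sub, noColumn_independent,
    h.blockExpectation_blockCertificate_mul_polyValue z hf]
  rfl

theorem blockExpectation_positiveCertificate_sq_le (h : LowSignal n d D lam p q)
    (hcol : (1 - q) ^ d ≤ 1 / 2) (z : Fin n) :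
    blockExpectation (d := d) lam p q (positiveCertificate D lam p q z ^ 2) ≤ 5 * p ^ 2 := by
  have correction_sq :
      blockExpectation lam p q
          ((fun ω => p * noColumn ω.1.2 : (Finset (Fin n) × Finset (Fin d)) × _ → ℝ) ^ 2) =
        p ^ 2 * (1 - q) ^ d := by
    have key := blockExpectation_comp_fst (lam := lam) (p := p) (q := q)
      (fun _ : Finset (Fin n) => p ^ 2) fun T : Finset (Fin d) => noColumn T
    rw [← sum_mul, sum_subsetProb, one_mul, sum_subsetProb_mul_noColumn] at key
    rw [← key]
    congr 1
    ext ω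
    rw [Pi.pow_apply, mul_pow, noColumn_sq]
  have sub_sq_le := map_sub_sq_le h.blockExpectation_sq_nonneg (blockCertificate D lam p q z)
    fun ω => p * noColumn ω.1.2
  rw [correction_sq] at sub_sq_le
  have certificate_le := h.blockExpectation_blockCertificate_sq_le z
  have correction_le := mul_le_mul_of_nonneg_left hcol (sq_nonneg p)
  unfold positiveCertificate
  linarith

theorem half_rowPositive_sq_le (h : LowSignal n d D lam p q) (hcol : (1 - q) ^ d ≤ 1 / 2)
    (z : Fin n) {f : MvPolynomial (Fin n × Fin d) ℝ} (hf : f.totalDegree ≤ D) :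
    blockExpectation (d := d) lam p q
        (fun ω => rowPositive (blockMatrix lam ω.1.1 ω.1.2) z ^ 2) / 2 ≤
      blockExpectation lam p q
        (fun ω => (polyValue f ω.2 - rowPositive (blockMatrix lam ω.1.1 ω.1.2) z) ^ 2) := by
  rcases h.lam_nonneg.eq_or_lt with rfl | hlam
  · have target_sq : blockExpectation (d := d) 0 p q
        (fun ω => rowPositive (blockMatrix 0 ω.1.1 ω.1.2) z ^ 2) = 0 := by
      simp only [blockMatrix_zero, rowPositive_zero, zero_pow two_ne_zero]
      exact LinearMap.map_zero _
    rw [target_sq, zero_div]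
    exact h.blockExpectation_sq_nonneg _
  · have dual_bound : blockExpectation lam p q
          (fun ω => rowPositive (blockMatrix lam ω.1.1 ω.1.2) z ^ 2) -
        blockExpectation lam p q (positiveCertificate D lam p q z ^ 2) ≤
          blockExpectation lam p q
            (fun ω => (polyValue f ω.2 - rowPositive (blockMatrix lam ω.1.1 ω.1.2) z) ^ 2) :=
      map_sq_sub_map_sq_le_map_sub_sq h.blockExpectation_sq_nonneg
        (h.blockExpectation_positiveCertificate_mul_polyValue hlam z hf)
    have certificate_le := h.blockExpectation_positiveCertificate_sq_le hcol z
    rw [blockExpectation_rowPositive_sq hlam] at dual_bound ⊢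
    nlinarith [h.row_nonneg, h.row_le]

end LowSignal

end LowSignal

section SignalCondition

theorem one_sub_div_pow_le_half {K d : ℕ} (hK : 1 ≤ K) (hKd : K ≤ d) :
    (1 - (K : ℝ) / d) ^ d ≤ 1 / 2 := by
  have one_le : (1 : ℝ) ≤ K := by exact_mod_cast hK
  calc (1 - (K : ℝ) / d) ^ d ≤ Real.exp (-K) :=
        Real.one_sub_div_pow_le_exp_neg (by exact_mod_cast hKd)
    _ ≤ Real.exp (-1) := Real.exp_le_exp.2 (neg_le_neg one_le)
    _ ≤ 1 / 2 := Real.exp_neg_one_lt_half.le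

theorem rpow_neg_eight_mul_le {x c : ℝ} (hx : 1 ≤ x) (hc : 1 ≤ c) :
    x ^ (-8 * c) ≤ (x ^ 8)⁻¹ := by
  rw [← Real.rpow_natCast, ← Real.rpow_neg (by positivity)]
  exact Real.rpow_le_rpow_of_exponent_le hx (by push_cast; linarith)

theorem inv_pow_eight_sq_le {x : ℝ} (hx : 2 ≤ x) :
    (x ^ 8)⁻¹ ^ 2 ≤ (8 * (x + 1) ^ 4)⁻¹ := by
  rw [inv_pow]
  refine inv_anti₀ (by positivity) ?_
  calc 8 * (x + 1) ^ 4 ≤ 8 * (2 * x) ^ 4 := by gcongr; linarith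
    _ = 2 ^ 7 * x ^ 4 := by ring
    _ ≤ x ^ 7 * x ^ 4 := by gcongr
    _ = x ^ 11 := by ring
    _ ≤ x ^ 16 := pow_le_pow_right₀ (by linarith) (by norm_num)
    _ = (x ^ 8) ^ 2 := by ring

theorem sq_mul_mul_div_sq {m : ℝ} (hm : 0 ≤ m) (x K : ℝ) :
    x ^ 2 * (m * (K / m) ^ 2) = (x * K / Real.sqrt m) ^ 2 := by
  rw [div_pow, div_pow (x * K), Real.sq_sqrt hm]
  rcases eq_or_ne m 0 with rfl | hm
  · simp
  · field_simp

theorem SignalCondition.lowSignal {n d D Kn Kd : ℕ} {lam c : ℝ}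
    (hD : 2 ≤ D) (hc : 1 ≤ c) (hKd : Kd ≤ d) (hlam : 0 ≤ lam)
    (h : SignalCondition n d D lam Kn Kd c) :
    LowSignal n d D lam ((Kn : ℝ) / n) ((Kd : ℝ) / d) := by
  have hD' : (2 : ℝ) ≤ D := by exact_mod_cast hD
  simp only [SignalCondition, max_le_iff] at h
  obtain ⟨⟨⟨⟨row, -⟩, row_signal⟩, col_signal⟩, entry_signal⟩ := h
  have scale_le : (D : ℝ) ^ (-8 * c) ≤ ((D : ℝ) ^ 8)⁻¹ :=
    rpow_neg_eight_mul_le (one_le_two.trans hD') hc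
  have scale_sq_le : ∀ {x : ℝ}, 0 ≤ x → x ≤ (D : ℝ) ^ (-8 * c) →
      x ^ 2 ≤ (8 * ((D : ℝ) + 1) ^ 4)⁻¹ := fun hx₀ hx =>
    (pow_le_pow_left₀ hx₀ (hx.trans scale_le) 2).trans (inv_pow_eight_sq_le hD')
  refine ⟨hlam, by positivity, ?_, by positivity,
    div_le_one_of_le₀ (by exact_mod_cast hKd) (by positivity), scale_sq_le hlam entry_signal,
    ?_, ?_⟩
  · calc (Kn : ℝ) / n ≤ ((D : ℝ) ^ 8)⁻¹ := row.trans scale_le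
      _ ≤ (2 ^ 8)⁻¹ := by gcongr
      _ ≤ 1 / 20 := by norm_num
  · rw [sq_mul_mul_div_sq (by positivity)]
    exact scale_sq_le (by positivity) row_signal
  · rw [sq_mul_mul_div_sq (by positivity)]
    exact scale_sq_le (by positivity) col_signal

end SignalCondition

end HiddenBlock

open HiddenBlock in
theorem mainTheorem1_general {n d D : ℕ} {lam p q : ℝ} (h : LowSignal n d D lam p q)
    (hcol : (1 - q) ^ d ≤ 1 / 2) (z : Fin n) {f : MvPolynomial (Fin n × Fin d) ℝ}
    (hf : f.totalDegree ≤ D) :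
    blockExpectation (d := d) lam p q
          (fun ω => rowPositive (blockMatrix lam ω.1.1 ω.1.2) z ^ 2) / 2 ≤
        blockExpectation lam p q
          (fun ω => (polyValue f ω.2 - rowPositive (blockMatrix lam ω.1.1 ω.1.2) z) ^ 2) ∧
      blockExpectation (d := d) lam p q (fun ω => rowSelected ω.1.1 z ^ 2) / 2 ≤
        blockExpectation lam p q (fun ω => (polyValue f ω.2 - rowSelected ω.1.1 z) ^ 2) :=
  ⟨h.half_rowPositive_sq_le hcol z hf, h.half_rowSelected_sq_le z hf⟩

theorem mainTheorem1 :
    ∃ c₀ : ℝ, 0 < c₀ ∧ ∀ c : ℝ, c₀ ≤ c →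
      ∀ (n d D Kn Kd : ℕ) (lam : ℝ) (hn : 0 < n),
        2 ≤ D → 1 ≤ Kn → Kn ≤ n → 1 ≤ Kd → Kd ≤ d → 0 ≤ lam →
        HiddenBlock.SignalCondition n d D lam Kn Kd c →
        ∀ f : MvPolynomial (Fin n × Fin d) ℝ, f.totalDegree ≤ D →
          (HiddenBlock.expectation n d lam Kn Kd (fun S T _ =>
                (HiddenBlock.rowPositive (HiddenBlock.blockMatrix lam S T) ⟨0, hn⟩) ^ 2) / 2
              ≤ HiddenBlock.expectation n d lam Kn Kd (fun S T Y =>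
                (HiddenBlock.polyValue f Y
                  - HiddenBlock.rowPositive (HiddenBlock.blockMatrix lam S T) ⟨0, hn⟩) ^ 2)) ∧
          (HiddenBlock.expectation n d lam Kn Kd (fun S _ _ =>
                (HiddenBlock.rowSelected S ⟨0, hn⟩) ^ 2) / 2
              ≤ HiddenBlock.expectation n d lam Kn Kd (fun S _ Y =>
                (HiddenBlock.polyValue f Y - HiddenBlock.rowSelected S ⟨0, hn⟩) ^ 2)) := by
  refine ⟨1, one_pos, fun c hc n d D Kn Kd lam hn hD _ _ hKd hKd' hlam hsignal f hf => ?_⟩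
  simpa only [HiddenBlock.expectation_eq_blockExpectation] using
    mainTheorem1_general (hsignal.lowSignal hD hc hKd' hlam)
      (HiddenBlock.one_sub_div_pow_le_half hKd hKd') ⟨0, hn⟩ hf
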